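/- **Theorem 5.3.** *Model.* $m$ items are sold one after the other to Bidder 1 and an adversary. In each round both players simultaneously bid nonnegative amounts, as functions of all earlier bids. The higher bidder wins the item and pays the higher bid (first-price) or the lower bid (second-price); ties go to a fixed player. Bidder 1 has a valuation $v:2^{I}\to\mathbb R_{\ge 0}$ on the set $I$ of items. The adversary has a budget $B$ and never bids more than $B$ minus what he has already paid. Bidder 1's profit is $v(S)$, for the set $S$ of items that she wins, minus the prices that she pays. Her guaranteed profit is $\pi_1^*(v,B)=\sup_{s_1}\inf_{s_2}(\text{profit})$, with $s_1,s_2$ ranging over the pure strategies ($s_2$ respecting the budget). For a class $\mathcal C$ of valuations, $\mathcal P(\mathcal C,B)=\inf_{v\in\mathcal C}\pi_1^*(v,B)$. $SI_m$ is the class of normalized ($v(\emptyset)=0$, $v(I)=1$), monotone, subadditive valuations on $m$ identical items ($v(S)$ depends only on $|S|$). Let $t^*(B)=\max_{k\ge1}\left(\frac1{k+1}-\frac Bk\right)$, the maximum being over integers $k \ge 1$. *Claim.* There is an absolute constant $C$ such that for every $B\in(0,\tfrac14)$ we have $$t^*(B)=\tfrac12-B<(1-\sqrt B)^2,$$ and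 there is $m_0=m_0(B)$ such that for all $m\ge m_0$, for first-price and second-price auctions and for either tie-breaking rule, $$t^*(B)-\frac Cm\;\le\;\mathcal P(SI_m,B)\;\le\;t^*(B)+\frac{C}{\sqrt m}.$$ Moreover, the valuation $v$ given by $v(S)=0$ for $|S|=0$, $v(S)=\frac{1-4B}{2}+(|S|-1)\frac{4B}{m-2}$ for $1\le |S|\le m-1$, and $v(S)=1$ for $|S|=m$ belongs to $SI_m$, and for this $v$ the adversary has a single pure strategy, respecting the budget $B$, against which every strategy of Bidder 1 makes a profit of at most $t^*(B)+\frac{C}{\sqrt m}$. -/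

import Mathlib

open scoped NNReal

noncomputable section

/-- The rules by which each single item is sold: first-price or second-price, and who receives the
item when the two bids are equal. -/
structure AuctionFormat where
  secondPrice : Bool
  tieToBidderOne : Bool

/-- A pair of bids on one item: `b.1` is the bid of Bidder 1, `b.2` the bid of the adversary. -/
abbrev BidPair := ℝ≥0 × ℝ≥0

namespace AuctionFormat

/-- Bidder 1 receives the item. -/
def BidderOneWins (F : AuctionFormat) (b : BidPair) : Prop :=
  b.2 < b.1 ∨ (b.2 = b.1 ∧ F.tieToBidderOne = true)

/-- What the winner of the item pays: the highest bid (first-price) or the lower of the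
two bids (second-price). -/
def price (F : AuctionFormat) (b : BidPair) : ℝ≥0 :=
  if F.secondPrice = true then min b.1 b.2 else max b.1 b.2

open Classical in
/-- What Bidder 1 pays in a round with bids `b`. -/
def payOne (F : AuctionFormat) (b : BidPair) : ℝ :=
  if F.BidderOneWins b then (F.price b : ℝ) else 0

open Classical in
/-- What the adversary pays in a round with bids `b`. -/
def payTwo (F : AuctionFormat) (b : BidPair) : ℝ :=
  if F.BidderOneWins b then 0 else (F.price b : ℝ)

end AuctionFormat

/-- The bids of both players on all items sold so far, latest item first. (The allocation and the
payments so far are determined by these bids.) -/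
abbrev History := List BidPair

/-- A pure strategy of either player: the bid on the next item as a function of the history. -/
abbrev Strategy := History → ℝ≥0

/-- The total amount that the adversary paid in the history `h`. -/
def AuctionFormat.adversarySpent (F : AuctionFormat) (h : History) : ℝ :=
  (h.map F.payTwo).sum

/-- The adversary strategy `s` respects the budget `B`: no bid ever exceeds what is left of
the budget (histories in which the budget is already exceeded cannot occur). -/
def AuctionFormat.Feasible (F : AuctionFormat) (B : ℝ) (s : Strategy) : Prop :=
  ∀ h : History, F.adversarySpent h ≤ B → (s h : ℝ) ≤ B - F.adversarySpent h

/-- The history after `t` items have been sold, when the players use `s₁` and `s₂`. In each round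
the two bids are made simultaneously. -/
def playHistory (s₁ s₂ : Strategy) : ℕ → History
  | 0 => []
  | t + 1 => (s₁ (playHistory s₁ s₂ t), s₂ (playHistory s₁ s₂ t)) :: playHistory s₁ s₂ t

/-- The bids on the item number `t` (counted from `0`). -/
def roundBids (s₁ s₂ : Strategy) (t : ℕ) : BidPair :=
  (s₁ (playHistory s₁ s₂ t), s₂ (playHistory s₁ s₂ t))

open Classical in
/-- The set of items, among `m` items sold one after the other, that Bidder 1 wins. -/
def itemsWon (F : AuctionFormat) (m : ℕ) (s₁ s₂ : Strategy) : Finset (Fin m) :=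
  Finset.univ.filter fun t => F.BidderOneWins (roundBids s₁ s₂ t)

/-- The profit of Bidder 1: her value for the items she wins minus what she pays. -/
def profit (F : AuctionFormat) {m : ℕ} (v : Finset (Fin m) → ℝ) (s₁ s₂ : Strategy) : ℝ :=
  v (itemsWon F m s₁ s₂) - ∑ t : Fin m, F.payOne (roundBids s₁ s₂ t)

/-- The guaranteed profit of Bidder 1 with valuation `v` against an adversary with budget `B`:
the supremum over her strategies of the worst-case profit. (Extended reals, since a careless
strategy may have unbounded losses.) -/
def guaranteedProfit (F : AuctionFormat) {m : ℕ} (v : Finset (Fin m) → ℝ) (B : ℝ) : EReal :=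
  ⨆ s₁ : Strategy, ⨅ s₂ : {s : Strategy // F.Feasible B s}, (profit F v s₁ s₂.1 : EReal)

/-- The risk-free profitability of a class of valuations on `m` items. -/
def riskFreeProfitability (F : AuctionFormat) {m : ℕ} (𝒞 : Set (Finset (Fin m) → ℝ)) (B : ℝ) :
    EReal :=
  ⨅ v ∈ 𝒞, guaranteedProfit F v B

/-- The normalized, monotone, subadditive valuations on `m` identical items. -/
structure IsSubadditiveIdentical {m : ℕ} (v : Finset (Fin m) → ℝ) : Prop where
  empty : v ∅ = 0
  univ : v Finset.univ = 1
  mono : ∀ S T : Finset (Fin m), S ⊆ T → v S ≤ v T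
  subadditive : ∀ S T : Finset (Fin m), v (S ∪ T) ≤ v S + v T
  identical : ∀ S T : Finset (Fin m), S.card = T.card → v S = v T

/-- The class of all normalized subadditive valuations on `m` identical items. -/
def SI (m : ℕ) : Set (Finset (Fin m) → ℝ) := {v | IsSubadditiveIdentical v}

/-- `t*(B) = max_{k ≥ 1} (1 / (k + 1) - B / k)`. -/
def tStar (B : ℝ) : ℝ := ⨆ k : ℕ+, (1 / ((k : ℝ) + 1) - B / (k : ℝ))

/-- The explicit valuation: the first and the last item have marginal value `(1 - 4B) / 2`, and each
of the `m - 2` items in between has marginal value `4B / (m - 2)`. -/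
def witnessValuation (B : ℝ) (m : ℕ) (S : Finset (Fin m)) : ℝ :=
  if S.card = 0 then 0
  else if S.card = m then 1
  else (1 - 4 * B) / 2 + ((S.card : ℝ) - 1) * (4 * B / ((m : ℝ) - 2))

end

/-! Lower bound: half of the items are worth at least 1/2 by subadditivity. Bidding about 2B/m until
half of the items are won costs about B, and the adversary cannot afford to win more than half at
that price (`le_guaranteedProfit`).

Upper bound: short of winning everything, the witness valuation is at most (1 - 4B)/2 plus an
additive part of total value about 4B. On n additive items of value 1, an adversary with budget s ≤
n can hold Bidder 1 to about (√n - √s)². Here this gives (√(4B) - √B)² = B, hence a profit of about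
(1 - 4B)/2 + B = 1/2 - B. The bound is a potential argument: additive profit so far plus potential
never increases (`guardStrategy_additive_profit_le`). To defend the jump at the full set, the
adversary bids his whole remaining budget on the last √m items. If Bidder 1 has won everything, that
budget is still B, so she pays at least B√m ≥ 1/2 + B (`guardStrategy_spent_of_all_won`). Giving up
those items costs only O(1/√m) of additive value. -/

open Real

/-! ### Accounting along a play -/

section Rounds

namespace AuctionFormat

variable (F : AuctionFormat) (b : BidPair)

open Classical in
/-- The number of items (one or zero) that Bidder 1 wins in a round with bids `b`. -/
noncomputable def winOne : ℕ := if F.BidderOneWins b then 1 else 0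

/-- The number of items that Bidder 1 won in the history `h`. -/
noncomputable def wonCount (h : History) : ℕ := (h.map F.winOne).sum

/-- The total amount that Bidder 1 paid in the history `h`. -/
noncomputable def bidderOneSpent (h : History) : ℝ := (h.map F.payOne).sum

/-- The only fact about prices and ties that the arguments need: the winner pays an amount between
the two bids. It makes the proof uniform in the auction format. -/
theorem round_won_or_lost :
    (F.winOne b = 1 ∧ F.payTwo b = 0 ∧ (b.2 : ℝ) ≤ F.payOne b ∧ F.payOne b ≤ b.1) ∨
      (F.winOne b = 0 ∧ F.payOne b = 0 ∧ (b.1 : ℝ) ≤ F.payTwo b ∧ F.payTwo b ≤ b.2) := by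
  by_cases hw : F.BidderOneWins b
  · left
    have h21 : b.2 ≤ b.1 := by
      rcases hw with h | h
      · exact h.le
      · exact h.1.le
    refine ⟨by simp [winOne, hw], by simp [payTwo, hw], ?_, ?_⟩
    · simp only [payOne, hw, if_true, price]
      split_ifs <;> simp [h21]
    · simp only [payOne, hw, if_true, price]
      split_ifs <;> simp [h21]
  · right
    have h12 : b.1 ≤ b.2 := by
      by_contra h
      exact hw (Or.inl (not_le.mp h))
    refine ⟨by simp [winOne, hw], by simp [payOne, hw], ?_, ?_⟩
    · simp only [payTwo, hw, if_false, price]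
      split_ifs <;> simp [h12]
    · simp only [payTwo, hw, if_false, price]
      split_ifs <;> simp [h12]

theorem payTwo_le : F.payTwo b ≤ b.2 := by
  rcases F.round_won_or_lost b with h | h
  · rw [h.2.1]; exact b.2.2
  · exact h.2.2.2

theorem wonCount_cons (h : History) : F.wonCount (b :: h) = F.winOne b + F.wonCount h := by
  simp [wonCount]

theorem bidderOneSpent_cons (h : History) :
    F.bidderOneSpent (b :: h) = F.payOne b + F.bidderOneSpent h := by
  simp [bidderOneSpent]

theorem adversarySpent_cons (h : History) :
    F.adversarySpent (b :: h) = F.payTwo b + F.adversarySpent h := by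
  simp [adversarySpent]

theorem adversarySpent_playHistory_le {B : ℝ} (hB : 0 ≤ B) {s₂ : Strategy}
    (hs : F.Feasible B s₂) (s₁ : Strategy) (t : ℕ) :
    F.adversarySpent (playHistory s₁ s₂ t) ≤ B := by
  induction t with
  | zero => simpa [playHistory, adversarySpent] using hB
  | succ t ih =>
    rw [playHistory, adversarySpent_cons]
    have h1 := F.payTwo_le (s₁ (playHistory s₁ s₂ t), s₂ (playHistory s₁ s₂ t))
    have h2 := hs _ ih
    simp only at h1
    linarith

end AuctionFormat

theorem length_playHistory (s₁ s₂ : Strategy) (t : ℕ) : (playHistory s₁ s₂ t).length = t := by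
  induction t with
  | zero => rfl
  | succ t ih => simp [playHistory, ih]

theorem sum_roundBids {M : Type*} [AddCommMonoid M] (f : BidPair → M) (s₁ s₂ : Strategy) (m : ℕ) :
    ∑ t : Fin m, f (roundBids s₁ s₂ t) = ((playHistory s₁ s₂ m).map f).sum := by
  induction m with
  | zero => simp [playHistory]
  | succ m ih =>
    rw [Fin.sum_univ_castSucc]
    simp only [Fin.val_castSucc, Fin.val_last]
    rw [ih, playHistory, List.map_cons, List.sum_cons, add_comm]
    rfl

theorem card_itemsWon (F : AuctionFormat) (m : ℕ) (s₁ s₂ : Strategy) :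
    (itemsWon F m s₁ s₂).card = F.wonCount (playHistory s₁ s₂ m) := by
  classical
  rw [itemsWon, Finset.card_filter, AuctionFormat.wonCount, ← sum_roundBids]
  refine Finset.sum_congr rfl fun t _ => ?_
  simp [AuctionFormat.winOne]

theorem profit_eq (F : AuctionFormat) {m : ℕ} (v : Finset (Fin m) → ℝ) (s₁ s₂ : Strategy) :
    profit F v s₁ s₂ =
      v (itemsWon F m s₁ s₂) - F.bidderOneSpent (playHistory s₁ s₂ m) := by
  rw [profit, sum_roundBids, AuctionFormat.bidderOneSpent]

end Rounds

/-! ### The value of t*(B) -/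

section TStar

theorem tStar_eq {B : ℝ} (hB : B < 1 / 4) : tStar B = 1 / 2 - B := by
  have key : ∀ k : ℕ+, 1 / ((k : ℝ) + 1) - B / (k : ℝ) ≤ 1 / 2 - B := by
    intro k
    have hk : (1 : ℝ) ≤ (k : ℝ) := by exact_mod_cast (one_le : 1 ≤ k)
    have hk0 : (0 : ℝ) < (k : ℝ) := by linarith
    have : 1 / 2 - B - (1 / ((k : ℝ) + 1) - B / (k : ℝ)) =
        ((k : ℝ) - 1) * ((k : ℝ) - 2 * B * ((k : ℝ) + 1)) / (2 * k * (k + 1)) := by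
      field_simp
      ring
    have h2 : 0 ≤ ((k : ℝ) - 1) * ((k : ℝ) - 2 * B * ((k : ℝ) + 1)) / (2 * k * (k + 1)) := by
      apply div_nonneg _ (by positivity)
      apply mul_nonneg (by linarith)
      nlinarith
    linarith
  apply le_antisymm
  · exact ciSup_le key
  · have := le_ciSup (f := fun k : ℕ+ => 1 / ((k : ℝ) + 1) - B / (k : ℝ))
      ⟨1 / 2 - B, by rintro _ ⟨k, rfl⟩; exact key k⟩ 1
    norm_num at this
    rw [tStar]
    norm_num
    exact this

theorem half_sub_lt_sq {B : ℝ} (hB0 : 0 < B) (hB : B < 1 / 4) : 1 / 2 - B < (1 - √B) ^ 2 := by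
  have h1 : √B ^ 2 = B := Real.sq_sqrt hB0.le
  have h2 : 0 ≤ √B := Real.sqrt_nonneg B
  have h3 : √B < 1 / 2 := by
    rw [Real.sqrt_lt' (by norm_num)]
    linarith
  -- The difference of the two sides is 2(1/2 - √B)².
  nlinarith [mul_pos (sub_pos.mpr h3) (sub_pos.mpr h3)]

end TStar

/-! ### Lower bound: a constant bid wins half of the items -/

section LowerBound

theorem IsSubadditiveIdentical.half_le {m : ℕ} {v : Finset (Fin m) → ℝ}
    (hv : IsSubadditiveIdentical v) {S : Finset (Fin m)} (hS : m ≤ 2 * S.card) :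
    1 / 2 ≤ v S := by
  have hc : Sᶜ.card ≤ S.card := by
    rw [Finset.card_compl, Fintype.card_fin]
    omega
  obtain ⟨T, hTS, hT⟩ := Finset.exists_subset_card_eq hc
  have h1 := hv.subadditive S Sᶜ
  rw [Finset.union_compl, hv.univ, ← hv.identical T Sᶜ hT] at h1
  linarith [hv.mono T S hTS]

/-- Bid the constant `p` until `k` items are won, and nothing afterwards. -/
noncomputable def constantBidUntil (F : AuctionFormat) (p : ℝ≥0) (k : ℕ) : Strategy :=
  fun h => if F.wonCount h < k then p else 0

/-- Before the target is reached, each lost round costs the adversary at least `p`; afterwards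
Bidder 1 may still win items by ties, but at price 0. -/
theorem constantBidUntil_invariant (F : AuctionFormat) (p : ℝ≥0) (k : ℕ) (s₂ : Strategy) (t : ℕ) :
    F.bidderOneSpent (playHistory (constantBidUntil F p k) s₂ t) ≤ p * k ∧
    (F.wonCount (playHistory (constantBidUntil F p k) s₂ t) < k →
      F.bidderOneSpent (playHistory (constantBidUntil F p k) s₂ t) ≤
        p * F.wonCount (playHistory (constantBidUntil F p k) s₂ t) ∧
      p * ((t : ℝ) - F.wonCount (playHistory (constantBidUntil F p k) s₂ t)) ≤
        F.adversarySpent (playHistory (constantBidUntil F p k) s₂ t)) := by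
  induction t with
  | zero =>
    simp only [playHistory, AuctionFormat.bidderOneSpent, AuctionFormat.wonCount,
      AuctionFormat.adversarySpent]
    simp
    positivity
  | succ t ih =>
    obtain ⟨ih1, ih2⟩ := ih
    rw [playHistory, AuctionFormat.bidderOneSpent_cons, AuctionFormat.wonCount_cons,
      AuctionFormat.adversarySpent_cons]
    set h := playHistory (constantBidUntil F p k) s₂ t
    have hp : (0 : ℝ) ≤ p := p.2
    rcases lt_or_ge (F.wonCount h) k with hk | hk
    · have hbid : constantBidUntil F p k h = p := by simp [constantBidUntil, hk]
      obtain ⟨ih3, ih4⟩ := ih2 hk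
      have hk' : (F.wonCount h : ℝ) + 1 ≤ k := by exact_mod_cast hk
      rcases F.round_won_or_lost (constantBidUntil F p k h, s₂ h) with hr | hr
      · obtain ⟨h1, h2, -, h4⟩ := hr
        simp only [hbid] at h1 h2 h4 ⊢
        rw [h1, h2]
        push_cast
        refine ⟨by nlinarith, fun _ => ⟨by nlinarith, by nlinarith⟩⟩
      · obtain ⟨h1, h2, h3, -⟩ := hr
        simp only [hbid] at h1 h2 h3 ⊢
        rw [h1, h2]
        push_cast
        refine ⟨by nlinarith, fun _ => ⟨by nlinarith, by nlinarith⟩⟩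
    · have hbid : constantBidUntil F p k h = 0 := by simp [constantBidUntil, not_lt.mpr hk]
      refine ⟨?_, fun hlt => by omega⟩
      rcases F.round_won_or_lost (constantBidUntil F p k h, s₂ h) with hr | hr
      · have := hr.2.2.2
        rw [hbid] at this ⊢
        simp only [NNReal.coe_zero] at this
        linarith
      · rw [hr.2.1]
        linarith

theorem le_guaranteedProfit (F : AuctionFormat) {B : ℝ} (hB0 : 0 < B) (hB : B < 1 / 4) {m : ℕ}
    (hm : 2 ≤ m) {v : Finset (Fin m) → ℝ} (hv : IsSubadditiveIdentical v) :
    ((1 / 2 - B - 1 / m : ℝ) : EReal) ≤ guaranteedProfit F v B := by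
  have hq : (1 : ℝ) ≤ ((m / 2 : ℕ) : ℝ) := by
    have : 1 ≤ m / 2 := by omega
    exact_mod_cast this
  have hq0 : (0 : ℝ) < ((m / 2 : ℕ) : ℝ) := by linarith
  have hm4 : (m : ℝ) ≤ 4 * ((m / 2 : ℕ) : ℝ) := by
    have : m ≤ 4 * (m / 2) := by omega
    exact_mod_cast this
  have hm0 : (0 : ℝ) < m := by
    have : 0 < m := by omega
    exact_mod_cast this
  set q : ℝ := ((m / 2 : ℕ) : ℝ) with hqdef
  -- At this price the adversary can win at most ⌊m/2⌋ items, leaving ⌈m/2⌉ = `k` to Bidder 1.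
  let p : ℝ≥0 := ⟨B / q, by positivity⟩
  have hpq : (p : ℝ) * q = B := by
    change B / q * q = B
    field_simp
  have hp0 : (0 : ℝ) < p := by
    change 0 < B / q
    positivity
  set k : ℕ := (m + 1) / 2 with hk
  have hkq : (k : ℝ) ≤ q + 1 := by
    have : k ≤ m / 2 + 1 := by omega
    rw [hqdef]
    exact_mod_cast this
  refine le_iSup_of_le (constantBidUntil F p k) (le_iInf fun s₂ => ?_)
  obtain ⟨s₂, hs₂⟩ := s₂
  rw [EReal.coe_le_coe_iff, profit_eq]
  obtain ⟨h1, h2⟩ := constantBidUntil_invariant F p k s₂ m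
  have hspent := F.adversarySpent_playHistory_le hB0.le hs₂ (constantBidUntil F p k) m
  have hwon : k ≤ F.wonCount (playHistory (constantBidUntil F p k) s₂ m) := by
    by_contra hlt
    rw [not_le] at hlt
    have h3 := (h2 hlt).2
    have h4 : q + 1 ≤ (m : ℝ) - F.wonCount (playHistory (constantBidUntil F p k) s₂ m) := by
      have : m / 2 + 1 + F.wonCount (playHistory (constantBidUntil F p k) s₂ m) ≤ m := by omega
      have h5 : ((m / 2 : ℕ) : ℝ) + 1 +
          F.wonCount (playHistory (constantBidUntil F p k) s₂ m) ≤ m := by exact_mod_cast this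
      linarith
    nlinarith
  have hhalf : 1 / 2 ≤ v (itemsWon F m (constantBidUntil F p k) s₂) := by
    apply hv.half_le
    rw [card_itemsWon]
    omega
  have hpm : (p : ℝ) ≤ 1 / m := by
    rw [le_div_iff₀ hm0]
    nlinarith
  nlinarith

theorem le_riskFreeProfitability (F : AuctionFormat) {B : ℝ} (hB0 : 0 < B) (hB : B < 1 / 4) {m : ℕ}
    (hm : 2 ≤ m) : ((1 / 2 - B - 1 / m : ℝ) : EReal) ≤ riskFreeProfitability F (SI m) B :=
  le_iInf₂ fun _ hv => le_guaranteedProfit F hB0 hB hm hv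

end LowerBound

/-! ### The explicit valuation -/

section Witness

theorem witnessValuation_of_card_eq (B : ℝ) {m : ℕ} (hm : m ≠ 0) {S : Finset (Fin m)}
    (hS : S.card = m) : witnessValuation B m S = 1 := by
  simp [witnessValuation, hS, hm]

/-- Two nonempty sets count the initial jump (1 - 4B)/2 twice. If their union is everything, the
second copy matches the jump of the last item; otherwise it must cover one middle marginal, which is
`hstep`. -/
theorem witnessValuation_mem {B : ℝ} (hB0 : 0 < B) (hB : B < 1 / 4) {m : ℕ} (hm : 3 ≤ m)
    (hstep : 4 * B / ((m : ℝ) - 2) ≤ (1 - 4 * B) / 2) : witnessValuation B m ∈ SI m := by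
  have hm3 : (3 : ℝ) ≤ m := by exact_mod_cast hm
  have ha0 : 0 < 4 * B / ((m : ℝ) - 2) := div_pos (by linarith) (by linarith)
  have ham : 4 * B / ((m : ℝ) - 2) * ((m : ℝ) - 2) = 4 * B :=
    div_mul_cancel₀ _ (by linarith)
  set a := 4 * B / ((m : ℝ) - 2) with ha
  have hcard : ∀ S : Finset (Fin m), S.card ≤ m := fun S => by
    simpa using Finset.card_le_univ S
  have hone : ∀ S : Finset (Fin m), witnessValuation B m S ≤ 1 := by
    intro S
    unfold witnessValuation
    split_ifs with h0 h1
    · norm_num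
    · exact le_rfl
    · have : (S.card : ℝ) + 1 ≤ m := by
        have := hcard S
        exact_mod_cast (by omega : S.card + 1 ≤ m)
      rw [← ha]
      nlinarith
  have hnonneg : ∀ S : Finset (Fin m), 0 ≤ witnessValuation B m S := by
    intro S
    unfold witnessValuation
    split_ifs with h0 h1
    · exact le_rfl
    · norm_num
    · have : (1 : ℝ) ≤ S.card := by exact_mod_cast (by omega : 1 ≤ S.card)
      rw [← ha]
      nlinarith
  have hmono : ∀ S T : Finset (Fin m), S ⊆ T →
      witnessValuation B m S ≤ witnessValuation B m T := by
    intro S T hST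
    have hc := Finset.card_le_card hST
    have hTm := hcard T
    by_cases hS0 : S.card = 0
    · have : witnessValuation B m S = 0 := by simp [witnessValuation, hS0]
      rw [this]
      exact hnonneg T
    by_cases hT : T.card = m
    · have := witnessValuation_of_card_eq B (by omega) hT
      rw [this]
      exact hone S
    · have hc' : (S.card : ℝ) ≤ T.card := by exact_mod_cast hc
      have hT0 : T.card ≠ 0 := by omega
      have hS : S.card ≠ m := by omega
      simp only [witnessValuation, hS0, hT0, hS, hT, if_false]
      rw [← ha]
      nlinarith
  refine ⟨by simp [witnessValuation], ?_, hmono, ?_, ?_⟩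
  · exact witnessValuation_of_card_eq B (by omega) (by simp)
  · intro S T
    have hc := Finset.card_union_le S T
    have hSm := hcard S
    have hTm := hcard T
    by_cases hS0 : S.card = 0
    · rw [Finset.card_eq_zero.mp hS0, Finset.empty_union]
      linarith [hnonneg ∅]
    by_cases hT0 : T.card = 0
    · rw [Finset.card_eq_zero.mp hT0, Finset.union_empty]
      linarith [hnonneg ∅]
    by_cases hS : S.card = m
    · have := witnessValuation_of_card_eq B (by omega) hS
      linarith [hone (S ∪ T), hnonneg T]
    by_cases hT : T.card = m
    · have := witnessValuation_of_card_eq B (by omega) hT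
      linarith [hone (S ∪ T), hnonneg S]
    have hU0 : (S ∪ T).card ≠ 0 := by
      have := Finset.card_le_card (Finset.subset_union_left (s₁ := S) (s₂ := T))
      omega
    have hc' : ((S ∪ T).card : ℝ) ≤ S.card + T.card := by exact_mod_cast hc
    by_cases hU : (S ∪ T).card = m
    · simp only [witnessValuation, hS0, hT0, hU0, hS, hT, if_false]
      rw [if_pos hU, ← ha]
      rw [hU] at hc'
      nlinarith
    · simp only [witnessValuation, hS0, hT0, hU0, hS, hT, hU, if_false]
      rw [← ha]
      nlinarith
  · intro S T hST
    simp only [witnessValuation, hST]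

theorem witnessValuation_le {B : ℝ} (hB0 : 0 < B) (hB : B < 1 / 4) {m : ℕ} (hm : 3 ≤ m)
    {S : Finset (Fin m)} (hS : S.card ≠ m) :
    witnessValuation B m S ≤ (1 - 4 * B) / 2 + 4 * B / ((m : ℝ) - 2) * S.card := by
  have hm3 : (3 : ℝ) ≤ m := by exact_mod_cast hm
  have ha0 : 0 < 4 * B / ((m : ℝ) - 2) := div_pos (by linarith) (by linarith)
  unfold witnessValuation
  split_ifs with h0
  · rw [h0]
    push_cast
    linarith
  · nlinarith

end Witness

/-! ### The potential for additive items -/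

section Potential

/-- Up to the error term `2 √x`, the profit that Bidder 1 can secure on `x` remaining items of value
one each when the adversary has a budget `s ≤ x` left. -/
noncomputable def rootPotential (x s : ℝ) : ℝ := (√x - √s) ^ 2 + 2 * √x

theorem rootPotential_nonneg (x s : ℝ) : 0 ≤ rootPotential x s := by
  unfold rootPotential
  positivity

/-- For the regime where the adversary bids 0: the square grows by 1 - 2√s(√(x+1) - √x), and the
growth of 2√x makes up the deficit. -/
theorem one_add_rootPotential_le {x s : ℝ} (hx : 0 ≤ x) (hs : s ≤ 1) :
    1 + rootPotential x s ≤ rootPotential (x + 1) s := by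
  unfold rootPotential
  have h1 : √x ^ 2 = x := Real.sq_sqrt hx
  have h2 : √(x + 1) ^ 2 = x + 1 := Real.sq_sqrt (by linarith)
  have h3 : √x ≤ √(x + 1) := Real.sqrt_le_sqrt (by linarith)
  have h4 : √s ≤ 1 := Real.sqrt_le_one.mpr hs
  nlinarith [mul_nonneg (sub_nonneg.mpr h3) (sub_nonneg.mpr h4)]

theorem rootPotential_won_le {x : ℝ} (s : ℝ) (hx : 0 ≤ x) :
    1 - 2 * √s * (√(x + 1) - √x) + rootPotential x s ≤ rootPotential (x + 1) s := by
  unfold rootPotential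
  have h1 : √x ^ 2 = x := Real.sq_sqrt hx
  have h2 : √(x + 1) ^ 2 = x + 1 := Real.sq_sqrt (by linarith)
  have h3 : √x ≤ √(x + 1) := Real.sqrt_le_sqrt (by linarith)
  nlinarith

theorem sqrt_succ_sub_sqrt {x : ℝ} (hx : 1 ≤ x) :
    0 ≤ √(x + 1) - √x ∧ 2 * (√(x + 1) - √x) ≤ 1 ∧ 1 ≤ √x ∧
      (√(x + 1) - √x) * (√(x + 1) + √x) = 1 := by
  have h1 : √x ^ 2 = x := Real.sq_sqrt (by linarith)
  have h2 : √(x + 1) ^ 2 = x + 1 := Real.sq_sqrt (by linarith)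
  have h3 : √x ≤ √(x + 1) := Real.sqrt_le_sqrt (by linarith)
  have h4 : 1 ≤ √x := Real.one_le_sqrt.mpr hx
  refine ⟨by linarith, by nlinarith, h4, by nlinarith⟩

theorem rootBid_le {x s : ℝ} (hx : 1 ≤ x) (hs : 1 ≤ s) : 2 * √s * (√(x + 1) - √x) ≤ s := by
  obtain ⟨h1, h2, -, -⟩ := sqrt_succ_sub_sqrt hx
  have h3 : √s ^ 2 = s := Real.sq_sqrt (by linarith)
  have h4 : 1 ≤ √s := Real.one_le_sqrt.mpr hs
  nlinarith

/-- The bid makes the square change exactly right when Bidder 1 wins; when she loses there is a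
second-order error, absorbed by the growth of 2√x. -/
theorem rootPotential_lost_le {x s : ℝ} (hx : 1 ≤ x) (hs : 1 ≤ s) :
    rootPotential x (s - 2 * √s * (√(x + 1) - √x)) ≤ rootPotential (x + 1) s := by
  obtain ⟨hd0, hd1, hY, hdX⟩ := sqrt_succ_sub_sqrt hx
  have hbid := rootBid_le hx hs
  have h1 : √x ^ 2 = x := Real.sq_sqrt (by linarith)
  have h2 : √(x + 1) ^ 2 = x + 1 := Real.sq_sqrt (by linarith)
  have h3 : √s ^ 2 = s := Real.sq_sqrt (by linarith)
  have h4 : 1 ≤ √s := Real.one_le_sqrt.mpr hs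
  have h5 : √(s - 2 * √s * (√(x + 1) - √x)) ^ 2 = s - 2 * √s * (√(x + 1) - √x) :=
    Real.sq_sqrt (by linarith)
  have h6 : 0 ≤ √(s - 2 * √s * (√(x + 1) - √x)) := Real.sqrt_nonneg _
  unfold rootPotential
  set τ := √(s - 2 * √s * (√(x + 1) - √x))
  obtain ⟨d, hd⟩ : ∃ d, d = √(x + 1) - √x := ⟨_, rfl⟩
  rw [← hd] at hd0 hd1 hdX h5
  have hX : √(x + 1) = √x + d := by linarith
  rw [hX] at h2 hdX ⊢
  generalize √x = Y at *
  generalize √s = σ at *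
  have hτσ : τ ≤ σ := by nlinarith
  have he : σ - τ ≤ 2 * d := by nlinarith
  have hYd : 2 * Y * d ≤ 1 := by nlinarith
  have hsum : 2 * σ ≤ (1 + 2 * d) * (σ + τ) := by
    nlinarith [mul_nonneg hd0 (by linarith : 0 ≤ 2 * σ - 1 - 2 * d)]
  -- Expanding the squares reduces the claim to this; the 2d comes from the error term.
  have hmain : 2 * Y * (σ - τ) ≤ 1 + 2 * d := by
    have h7 : (2 * Y * (σ - τ)) * (σ + τ) ≤ (1 + 2 * d) * (σ + τ) := by
      have : (2 * Y * (σ - τ)) * (σ + τ) = (2 * Y * d) * (2 * σ) := by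
        linear_combination 2 * Y * h3 - 2 * Y * h5
      rw [this]
      nlinarith
    exact le_of_mul_le_mul_right h7 (by linarith)
  nlinarith

/-- Covers second-price rounds, where the adversary may pay less than his bid. -/
theorem rootPotential_antitone {x s s' : ℝ} (hss : s ≤ s') (hsx : s' ≤ x) :
    rootPotential x s' ≤ rootPotential x s := by
  unfold rootPotential
  have h1 : √s ≤ √s' := Real.sqrt_le_sqrt hss
  have h2 : √s' ≤ √x := Real.sqrt_le_sqrt hsx
  nlinarith

/-- The adversary's bid when `n` items are left and his budget is `s`, in units of the value of
an item: the whole budget on the last `n₀` items, the full value if he can afford it for all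
remaining items, nothing if he cannot afford a single item, and otherwise the bid that makes
Bidder 1 indifferent. -/
noncomputable def guardBid (n₀ n : ℕ) (s : ℝ) : ℝ :=
  if n ≤ n₀ then s else if (n : ℝ) ≤ s then 1 else if s ≤ 1 then 0
  else 2 * √s * (√n - √(n - 1 : ℝ))

/-- An upper bound for the additive profit of Bidder 1 against `guardBid`. -/
noncomputable def guardPotential (n₀ n : ℕ) (s : ℝ) : ℝ :=
  if n ≤ n₀ then n else n₀ + if (n : ℝ) ≤ s then 0 else rootPotential n s

theorem guardBid_nonneg (n₀ n : ℕ) {s : ℝ} (hs : 0 ≤ s) : 0 ≤ guardBid n₀ n s := by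
  unfold guardBid
  split_ifs
  · exact hs
  · exact zero_le_one
  · exact le_rfl
  · have : √(n - 1 : ℝ) ≤ √n := Real.sqrt_le_sqrt (by linarith)
    exact mul_nonneg (by positivity) (by linarith)

theorem guardBid_le (n₀ n : ℕ) {s : ℝ} (hs : 0 ≤ s) : guardBid n₀ n s ≤ s := by
  unfold guardBid
  split_ifs with h1 h2 h3
  · exact le_rfl
  · have : (1 : ℝ) ≤ n := by exact_mod_cast (by omega : 1 ≤ n)
    linarith
  · exact hs
  · have h4 : (1 : ℝ) < n := by linarith
    have h5 : 1 < n := by exact_mod_cast h4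
    obtain ⟨x, rfl⟩ : ∃ x, n = x + 1 := ⟨n - 1, by omega⟩
    have hx : (1 : ℝ) ≤ x := by exact_mod_cast (by omega : 1 ≤ x)
    push_cast
    rw [add_sub_cancel_right]
    exact rootBid_le hx (by linarith)

theorem guardPotential_zero (n₀ : ℕ) (s : ℝ) : guardPotential n₀ 0 s = 0 := by
  simp [guardPotential]

theorem guardPotential_le_add_rootPotential (n₀ n : ℕ) (s : ℝ) :
    guardPotential n₀ n s ≤ n₀ + rootPotential n s := by
  have := rootPotential_nonneg n s
  unfold guardPotential
  split_ifs with h1 h2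
  · have : (n : ℝ) ≤ n₀ := by exact_mod_cast h1
    linarith
  · linarith
  · exact le_rfl

theorem guardPotential_le_of_le {n₀ n : ℕ} {s : ℝ} (h : (n : ℝ) ≤ s) :
    guardPotential n₀ n s ≤ n₀ := by
  unfold guardPotential
  split_ifs with h1
  · exact_mod_cast h1
  · simp

theorem guardPotential_won_le (n₀ n : ℕ) {s : ℝ} (hs : 0 ≤ s) :
    1 - guardBid n₀ (n + 1) s + guardPotential n₀ n s ≤ guardPotential n₀ (n + 1) s := by
  have hn : (0 : ℝ) ≤ n := n.cast_nonneg
  by_cases h1 : n + 1 ≤ n₀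
  · have hp := guardBid_nonneg n₀ (n + 1) hs
    simp only [guardPotential, h1, (by omega : n ≤ n₀), if_true]
    push_cast
    linarith
  have hle := guardPotential_le_add_rootPotential n₀ n s
  by_cases h2 : ((n + 1 : ℕ) : ℝ) ≤ s
  · have : (n : ℝ) ≤ s := by push_cast at h2; linarith
    have := guardPotential_le_of_le (n₀ := n₀) this
    simp only [guardBid, h1, h2, if_true, if_false]
    rw [guardPotential.eq_def n₀ (n + 1), if_neg h1, if_pos h2]
    linarith
  rw [guardPotential.eq_def n₀ (n + 1), if_neg h1, if_neg h2, guardBid, if_neg h1, if_neg h2]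
  push_cast
  split_ifs with h3
  · linarith [one_add_rootPotential_le hn h3]
  · rw [add_sub_cancel_right]
    linarith [rootPotential_won_le s hn]

theorem guardPotential_lost_le (n₀ n : ℕ) {s p : ℝ} (hp0 : 0 ≤ p)
    (hp : p ≤ guardBid n₀ (n + 1) s) :
    guardPotential n₀ n (s - p) ≤ guardPotential n₀ (n + 1) s := by
  have hn : (0 : ℝ) ≤ n := n.cast_nonneg
  by_cases h1 : n + 1 ≤ n₀
  · simp only [guardPotential, h1, (by omega : n ≤ n₀), if_true]
    push_cast
    linarith
  have hR := rootPotential_nonneg (n + 1 : ℕ) s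
  rcases le_or_gt (n : ℝ) (s - p) with h4 | h4
  · refine (guardPotential_le_of_le h4).trans ?_
    rw [guardPotential.eq_def n₀ (n + 1), if_neg h1]
    split_ifs <;> linarith
  have hle := guardPotential_le_add_rootPotential n₀ n (s - p)
  by_cases h2 : ((n + 1 : ℕ) : ℝ) ≤ s
  · rw [guardBid, if_neg h1, if_pos h2] at hp
    push_cast at h2
    linarith
  rw [guardPotential.eq_def n₀ (n + 1), if_neg h1, if_neg h2]
  rw [guardBid, if_neg h1, if_neg h2] at hp
  push_cast at h2 hp hR ⊢
  split_ifs at hp with h3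
  · have : p = 0 := le_antisymm hp hp0
    subst this
    rw [sub_zero] at hle ⊢
    linarith [one_add_rootPotential_le hn h3]
  · rw [add_sub_cancel_right] at hp
    have h5 : 1 ≤ n := by
      rcases Nat.eq_zero_or_pos n with h | h
      · subst h
        simp only [Nat.cast_zero] at h2
        linarith
      · exact h
    have hx : (1 : ℝ) ≤ n := by exact_mod_cast h5
    have h6 := rootPotential_lost_le hx (not_le.mp h3).le
    have h7 := rootPotential_antitone
      (by linarith : s - 2 * √s * (√((n : ℝ) + 1) - √n) ≤ s - p) h4.le
    linarith

end Potential

/-! ### Upper bound: the adversary's strategy -/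

section UpperBound

/-- The adversary's strategy on `m` items for items of value `a` each, with
bids according to `guardBid`. -/
noncomputable def guardStrategy (F : AuctionFormat) (B a : ℝ) (n₀ m : ℕ) : Strategy :=
  fun h => (a * guardBid n₀ (m - h.length) ((B - F.adversarySpent h) / a)).toNNReal

theorem coe_guardStrategy {F : AuctionFormat} {B a : ℝ} (ha : 0 < a) (n₀ m : ℕ) {h : History}
    (hh : F.adversarySpent h ≤ B) :
    (guardStrategy F B a n₀ m h : ℝ) =
      a * guardBid n₀ (m - h.length) ((B - F.adversarySpent h) / a) :=
  Real.coe_toNNReal _ (mul_nonneg ha.le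
    (guardBid_nonneg _ _ (div_nonneg (sub_nonneg.mpr hh) ha.le)))

theorem guardStrategy_feasible (F : AuctionFormat) (B : ℝ) {a : ℝ} (ha : 0 < a) (n₀ m : ℕ) :
    F.Feasible B (guardStrategy F B a n₀ m) := by
  intro h hh
  rw [coe_guardStrategy ha n₀ m hh]
  calc a * guardBid n₀ (m - h.length) ((B - F.adversarySpent h) / a)
      ≤ a * ((B - F.adversarySpent h) / a) :=
        mul_le_mul_of_nonneg_left (guardBid_le _ _ (div_nonneg (sub_nonneg.mpr hh) ha.le)) ha.le
    _ = B - F.adversarySpent h := mul_div_cancel₀ _ ha.ne'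

theorem guardStrategy_additive_profit_le (F : AuctionFormat) {B a : ℝ} (hB : 0 ≤ B) (ha : 0 < a)
    (n₀ m : ℕ) (s₁ : Strategy) {t : ℕ} (ht : t ≤ m) :
    a * F.wonCount (playHistory s₁ (guardStrategy F B a n₀ m) t) -
        F.bidderOneSpent (playHistory s₁ (guardStrategy F B a n₀ m) t) +
        a * guardPotential n₀ (m - t)
          ((B - F.adversarySpent (playHistory s₁ (guardStrategy F B a n₀ m) t)) / a) ≤
      a * guardPotential n₀ m (B / a) := by
  induction t with
  | zero =>
    simp [playHistory, AuctionFormat.wonCount, AuctionFormat.bidderOneSpent,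
      AuctionFormat.adversarySpent]
  | succ t ih =>
    have ih := ih (by omega)
    have hspent := F.adversarySpent_playHistory_le hB (guardStrategy_feasible F B ha n₀ m) s₁ t
    have hbid := coe_guardStrategy ha n₀ m hspent
    rw [length_playHistory] at hbid
    rw [playHistory, AuctionFormat.bidderOneSpent_cons, AuctionFormat.wonCount_cons,
      AuctionFormat.adversarySpent_cons]
    set h := playHistory s₁ (guardStrategy F B a n₀ m) t
    obtain ⟨n, hn⟩ : ∃ n, m - t = n + 1 := ⟨m - t - 1, by omega⟩
    rw [(by omega : m - (t + 1) = n)]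
    rw [hn] at ih hbid
    have hs : 0 ≤ (B - F.adversarySpent h) / a := div_nonneg (sub_nonneg.mpr hspent) ha.le
    rcases F.round_won_or_lost (s₁ h, guardStrategy F B a n₀ m h) with hr | hr
    · obtain ⟨h1, h2, h3, -⟩ := hr
      simp only at h3
      rw [h1, h2, zero_add]
      push_cast
      nlinarith [mul_le_mul_of_nonneg_left (guardPotential_won_le n₀ n hs) ha.le]
    · obtain ⟨h1, h2, h3, h4⟩ := hr
      simp only at h3 h4
      rw [h1, h2]
      set p := F.payTwo (s₁ h, guardStrategy F B a n₀ m h)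
      have hp0 : 0 ≤ p := (s₁ h).2.trans h3
      have hdiv : (B - (p + F.adversarySpent h)) / a = (B - F.adversarySpent h) / a - p / a := by
        rw [← sub_div]
        ring
      have hp : p / a ≤ guardBid n₀ (n + 1) ((B - F.adversarySpent h) / a) := by
        rw [div_le_iff₀ ha]
        linarith
      have := guardPotential_lost_le n₀ n (div_nonneg hp0 ha.le) hp
      rw [hdiv, zero_add, zero_add]
      nlinarith [mul_le_mul_of_nonneg_left this ha.le]

theorem guardStrategy_spent_of_all_won (F : AuctionFormat) {B a : ℝ} (hB : 0 ≤ B) (ha : 0 < a)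
    {n₀ m : ℕ} (hn₀ : n₀ ≤ m) (s₁ : Strategy) (t : ℕ) :
    F.wonCount (playHistory s₁ (guardStrategy F B a n₀ m) t) ≤ t ∧
    (F.wonCount (playHistory s₁ (guardStrategy F B a n₀ m) t) = t →
      F.adversarySpent (playHistory s₁ (guardStrategy F B a n₀ m) t) = 0 ∧
      0 ≤ F.bidderOneSpent (playHistory s₁ (guardStrategy F B a n₀ m) t) ∧
      B * ((t : ℝ) - ((m : ℝ) - n₀)) ≤
        F.bidderOneSpent (playHistory s₁ (guardStrategy F B a n₀ m) t)) := by
  induction t with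
  | zero =>
    have : (n₀ : ℝ) ≤ m := by exact_mod_cast hn₀
    simp only [playHistory, AuctionFormat.wonCount, AuctionFormat.bidderOneSpent,
      AuctionFormat.adversarySpent]
    simp
    nlinarith
  | succ t ih =>
    obtain ⟨ih1, ih2⟩ := ih
    rw [playHistory, AuctionFormat.bidderOneSpent_cons, AuctionFormat.wonCount_cons,
      AuctionFormat.adversarySpent_cons]
    set h := playHistory s₁ (guardStrategy F B a n₀ m) t with hh
    rcases F.round_won_or_lost (s₁ h, guardStrategy F B a n₀ m h) with hr | hr
    · obtain ⟨h1, h2, h3, -⟩ := hr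
      simp only at h3
      rw [h1, h2]
      refine ⟨by omega, fun hall => ?_⟩
      obtain ⟨ih3, ih4, ih5⟩ := ih2 (by omega)
      have h0 : (0 : ℝ) ≤ guardStrategy F B a n₀ m h := NNReal.coe_nonneg _
      refine ⟨by rw [ih3, add_zero], by linarith, ?_⟩
      push_cast
      -- In the final phase the untouched budget makes the adversary bid `B`; before it, the claimed
      -- bound is at most 0.
      rcases le_or_gt (m - t) n₀ with hlast | hlast
      · have hbid := coe_guardStrategy ha n₀ m (ih3.le.trans hB)
        rw [hh, length_playHistory, ← hh, ih3, guardBid, if_pos hlast, sub_zero,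
          mul_div_cancel₀ _ ha.ne'] at hbid
        nlinarith
      · have : (t : ℝ) + 1 + n₀ ≤ m := by exact_mod_cast (by omega : t + 1 + n₀ ≤ m)
        nlinarith
    · rw [hr.1]
      exact ⟨by omega, fun hall => by omega⟩

/-- In units of one middle marginal the budget is (m - 2)/4, and (√m - √(m/4))² = m/4 scales back to
about B. -/
theorem scaled_guardPotential_le {B : ℝ} (hB0 : 0 < B) (hB : B < 1 / 4) {m : ℕ} (hm : 4 ≤ m) :
    4 * B / ((m : ℝ) - 2) * guardPotential (Nat.sqrt m) m (B / (4 * B / ((m : ℝ) - 2))) ≤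
      B + 10 / √m := by
  have hm4 : (4 : ℝ) ≤ m := by exact_mod_cast hm
  have hm2 : (0 : ℝ) < (m : ℝ) - 2 := by linarith
  have hs : B / (4 * B / ((m : ℝ) - 2)) = ((m : ℝ) - 2) / 4 := by
    field_simp
  rw [hs]
  have ha0 : 0 < 4 * B / ((m : ℝ) - 2) := by positivity
  have ham : 4 * B / ((m : ℝ) - 2) * ((m : ℝ) - 2) = 4 * B := div_mul_cancel₀ _ hm2.ne'
  set a := 4 * B / ((m : ℝ) - 2)
  have hr : √(m : ℝ) ^ 2 = m := Real.sq_sqrt (by linarith)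
  have hr2 : 2 ≤ √(m : ℝ) := Real.le_sqrt_of_sq_le (by linarith)
  have hn : (Nat.sqrt m : ℝ) ≤ √(m : ℝ) := Real.nat_sqrt_le_real_sqrt
  have hU := guardPotential_le_add_rootPotential (Nat.sqrt m) m (((m : ℝ) - 2) / 4)
  have hR : rootPotential m (((m : ℝ) - 2) / 4) ≤ 2 + ((m : ℝ) - 2) / 4 + 2 * √m := by
    have h1 : √(((m : ℝ) - 2) / 4) ^ 2 = ((m : ℝ) - 2) / 4 := Real.sq_sqrt (by linarith)
    have h2 : 0 ≤ √(((m : ℝ) - 2) / 4) := Real.sqrt_nonneg _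
    have h3 : 2 * √(((m : ℝ) - 2) / 4) ≤ √m := by
      apply Real.le_sqrt_of_sq_le
      nlinarith
    unfold rootPotential
    nlinarith
  have hbound : a * guardPotential (Nat.sqrt m) m (((m : ℝ) - 2) / 4) ≤
      a * (3 * √m + 2 + ((m : ℝ) - 2) / 4) := mul_le_mul_of_nonneg_left (by linarith) ha0.le
  have ham' : a * m ≤ 2 := by nlinarith
  have hfin : a * (3 * √m + 2) ≤ 10 / √m := by
    rw [le_div_iff₀ (by linarith)]
    nlinarith
  nlinarith

theorem guardStrategy_profit_le (F : AuctionFormat) {B : ℝ} (hB0 : 0 < B) (hB : B < 1 / 4) {m : ℕ}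
    (hm : 4 ≤ m) (hsqrt : 1 / 2 + B ≤ B * Nat.sqrt m) (s₁ : Strategy) :
    profit F (witnessValuation B m) s₁
        (guardStrategy F B (4 * B / ((m : ℝ) - 2)) (Nat.sqrt m) m) ≤ 1 / 2 - B + 10 / √m := by
  have hm4 : (4 : ℝ) ≤ m := by exact_mod_cast hm
  have ha0 : 0 < 4 * B / ((m : ℝ) - 2) := div_pos (by linarith) (by linarith)
  have herr : 0 ≤ 10 / √(m : ℝ) := by positivity
  have hadd := guardStrategy_additive_profit_le F hB0.le ha0 (Nat.sqrt m) m s₁ le_rfl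
  rw [Nat.sub_self, guardPotential_zero, mul_zero, add_zero] at hadd
  have hpot := scaled_guardPotential_le hB0 hB hm
  have hall := (guardStrategy_spent_of_all_won F hB0.le ha0 (Nat.sqrt_le_self m) s₁ m).2
  rw [profit_eq]
  rw [← card_itemsWon] at hadd hall
  by_cases hS : (itemsWon F m s₁
      (guardStrategy F B (4 * B / ((m : ℝ) - 2)) (Nat.sqrt m) m)).card = m
  · obtain ⟨-, -, h⟩ := hall hS
    rw [witnessValuation_of_card_eq B (by omega) hS]
    linarith
  · have hv := witnessValuation_le hB0 hB (by omega) hS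
    linarith

end UpperBound

/-! ### Assembly -/

theorem theorem5p3 :
    ∃ C : ℝ, ∀ B : ℝ, 0 < B → B < 1 / 4 →
      tStar B = 1 / 2 - B ∧
      tStar B < (1 - Real.sqrt B) ^ 2 ∧
      ∃ m₀ : ℕ, ∀ m : ℕ, m₀ ≤ m → ∀ F : AuctionFormat,
        -- the upper bound on the risk-free profitability
        riskFreeProfitability F (SI m) B ≤ ((tStar B + C / Real.sqrt m : ℝ) : EReal) ∧
        -- tightness
        ((tStar B - C / m : ℝ) : EReal) ≤ riskFreeProfitability F (SI m) B ∧
        -- the explicit valuation, for which one adversary strategy achieves the upper bound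
        witnessValuation B m ∈ SI m ∧
        ∃ s₂ : Strategy, F.Feasible B s₂ ∧
          ∀ s₁ : Strategy,
            profit F (witnessValuation B m) s₁ s₂ ≤ tStar B + C / Real.sqrt m := by
  refine ⟨10, fun B hB0 hB => ?_⟩
  rw [tStar_eq hB]
  refine ⟨rfl, half_sub_lt_sq hB0 hB, ?_⟩
  -- `N` makes winning every item unprofitable enough; `M` is for subadditivity of the witness.
  obtain ⟨N, hN⟩ := exists_nat_ge ((1 / 2 + B) / B)
  obtain ⟨M, hM⟩ := exists_nat_ge (2 / (1 - 4 * B))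
  refine ⟨N * N + M + 4, fun m hm F => ?_⟩
  have hm4 : 4 ≤ m := by omega
  have hm4' : (4 : ℝ) ≤ m := by exact_mod_cast hm4
  have hsqrt : 1 / 2 + B ≤ B * Nat.sqrt m := by
    have h1 : N ≤ Nat.sqrt m := Nat.le_sqrt.mpr (by omega)
    have h2 : (N : ℝ) ≤ Nat.sqrt m := by exact_mod_cast h1
    rw [div_le_iff₀ hB0] at hN
    nlinarith
  have hstep : 4 * B / ((m : ℝ) - 2) ≤ (1 - 4 * B) / 2 := by
    have h1 : (M : ℝ) + 4 ≤ m := by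
      exact_mod_cast (by nlinarith : M + 4 ≤ m)
    rw [div_le_iff₀ (by linarith)] at hM ⊢
    nlinarith
  have hwitness := witnessValuation_mem hB0 hB (by omega) hstep
  have ha0 : 0 < 4 * B / ((m : ℝ) - 2) := div_pos (by linarith) (by linarith)
  have hfeas := guardStrategy_feasible F B ha0 (Nat.sqrt m) m
  have hprofit := guardStrategy_profit_le F hB0 hB hm4 hsqrt
  refine ⟨?_, ?_, hwitness, _, hfeas, hprofit⟩
  · refine (iInf₂_le _ hwitness).trans (iSup_le fun s₁ => (iInf_le _ ⟨_, hfeas⟩).trans ?_)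
    exact EReal.coe_le_coe_iff.mpr (hprofit s₁)
  · refine le_trans ?_ (le_riskFreeProfitability F hB0 hB (by omega))
    rw [EReal.coe_le_coe_iff]
    have : (1 : ℝ) / m ≤ 10 / m := by gcongr; norm_num
    linarith
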